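/- Let $p$ be a prime and let $G$ be an abelian $p$-group. Let $\mathcal Q(G)$ denote the set of all subgroups $H\le G$ such that every homomorphism $H\to G$ extends to an endomorphism of $G$. Define $p^\sigma G$ for ordinals $\sigma$ by $p^0G=G$, $p^{\sigma+1}G=p(p^\sigma G)$, and $p^\sigma G=\bigcap_{\tau<\sigma}p^\tau G$ for limit $\sigma$. The height $h(x)$ of $x\in G$ is the ordinal $\sigma$ with $x\in p^\sigma G\setminus p^{\sigma+1}G$ if such a $\sigma$ exists, and $h(x)=\infty$ otherwise (that is, if $x\in p^\sigma G$ for all $\sigma$), where $\infty$ is larger than every ordinal. Let $H=\bigoplus_{i=1}^n H_i$ be a finite subgroup of $G$, where all the subgroups $H_i$ are cyclic. Then the following are equivalent: 1. $H\in\mathcal Q(G)$. 2. (a) $H_i\in\mathcal Q(G)$ for all $i=1,\dots,n$; and (b) $H=\bigoplus_{i=1}^n H_i$ is a valuated direct sum with respect to the valuation induced by heights in $G$, i.e. $h(x_1+\dots+x_n)=\min\{h(x_1),\dots,h(x_n)\}$ for all $x_1\in H_1,\dots,x_n\in H_n$. -/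

import Mathlib

universe u

namespace HomExtension

/-- The additive abelian group `G` is a `p`-group: every element has order a power of `p`. -/
def IsPrimaryGroup (p : ℕ) (G : Type u) [AddCommGroup G] : Prop :=
  ∀ x : G, ∃ k : ℕ, (p ^ k) • x = 0

/-- The set `Q(G)` of all subgroups `H` of `G` such that every homomorphism `H → G` extends to an
endomorphism of `G`. -/
def calQ (G : Type u) [AddCommGroup G] : Set (AddSubgroup G) :=
  {H | ∀ f : H →+ G, ∃ g : G →+ G, ∀ x : H, g (x : G) = f x}

/-- The transfinite chain of subgroups `p ^ σ G`: `p ^ 0 G = G`, `p ^ (σ + 1) G = p (p ^ σ G)`, and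
`p ^ σ G` is the intersection of all `p ^ τ G` with `τ < σ` when `σ` is a limit ordinal. -/
noncomputable def ppow (p : ℕ) (G : Type u) [AddCommGroup G] (σ : Ordinal.{u}) : AddSubgroup G :=
  Ordinal.limitRecOn σ ⊤
    (fun _ S => S.map (nsmulAddMonoidHom p))
    (fun σ _ S => ⨅ τ : Set.Iio σ, S τ.1 τ.2)

open Classical in
/-- The height of `x` in the `p`-group `G`: the ordinal `σ` with `x ∈ p ^ σ G` and
`x ∉ p ^ (σ + 1) G` if there is one (it is the least `σ` with `x ∉ p ^ (σ + 1) G`), and `∞`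
(written `⊤`) if `x` lies in every `p ^ σ G`. -/
noncomputable def height (p : ℕ) {G : Type u} [AddCommGroup G] (x : G) : WithTop Ordinal.{u} :=
  if ∃ σ : Ordinal.{u}, x ∉ ppow p G (σ + 1) then
    ((sInf {σ : Ordinal.{u} | x ∉ ppow p G (σ + 1)} : Ordinal.{u}) : WithTop Ordinal.{u})
  else ⊤

/-- The subgroup `H` of `G` is the (internal) direct sum of the subgroups `K i`. -/
structure IsDirectSum {G : Type u} [AddCommGroup G] {n : ℕ} (H : AddSubgroup G)
    (K : Fin n → AddSubgroup G) : Prop where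
  indep : iSupIndep K
  iSup_eq : ⨆ i, K i = H

/-- `H` is the valuated direct sum of the `K i`, for the valuation induced by heights in `G`:
it is their direct sum, and the height in `G` of a sum of elements `x i ∈ K i` is the minimum of
their heights in `G` (`∞` for the empty sum). -/
structure IsValuatedDirectSum (p : ℕ) {G : Type u} [AddCommGroup G] {n : ℕ} (H : AddSubgroup G)
    (K : Fin n → AddSubgroup G) : Prop extends IsDirectSum H K where
  height_sum : ∀ x : Fin n → G, (∀ i, x i ∈ K i) →
    height p (∑ i, x i) = Finset.univ.inf fun i => height p (x i)

end HomExtension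

namespace HomExtension

/-! ### Heights and the subgroups `ppow p G σ` -/

section Heights

variable {p : ℕ} {G : Type u} [AddCommGroup G]

/-! Endomorphisms never lower heights. If `H` is in `calQ G`, extending the projections onto the `K
i` bounds the height of a sum by that of each term; the other inequality is automatic. Conversely,
(a) and (b) make every `f : H →+ G` height-nondecreasing (`IsValuatedDirectSum.map_mem_ppow`), and
`exists_extension` extends such a map using only the finite levels up to some `k`. If `p ^ k G` is
`p`-divisible for some `k`, it applies directly. Otherwise nonzero elements of each `K i` have
finite height (`exists_notMem_ppow_of_mem_calQ`), so the finite group `H` meets some `p ^ k G`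
trivially, and `f` is first extended by zero to `H ⊕ p ^ k G`. -/

theorem ppow_zero : ppow p G 0 = ⊤ := by
  simp [ppow]

theorem ppow_succ (σ : Ordinal.{u}) :
    ppow p G (σ + 1) = (ppow p G σ).map (nsmulAddMonoidHom p) := by
  simp only [ppow]
  rw [Ordinal.limitRecOn_add_one]

theorem ppow_limit {σ : Ordinal.{u}} (hσ : Order.IsSuccLimit σ) :
    ppow p G σ = ⨅ τ : Set.Iio σ, ppow p G τ.1 := by
  simp only [ppow]
  rw [Ordinal.limitRecOn_limit _ _ _ _ hσ]

theorem ppow_antitone : Antitone (ppow p G) := by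
  have succ_le : ∀ σ : Ordinal.{u}, ppow p G (σ + 1) ≤ ppow p G σ := by
    intro σ
    rw [ppow_succ]
    rintro _ ⟨x, hx, rfl⟩
    exact (ppow p G σ).nsmul_mem hx p
  intro σ τ
  induction τ using Ordinal.limitRecOn with
  | zero => intro h; rw [nonpos_iff_eq_zero.mp h]
  | add_one τ ih =>
    intro h
    rcases h.eq_or_lt with rfl | h
    · exact le_rfl
    · exact (succ_le τ).trans (ih (Order.lt_succ_iff.mp h))
  | limit τ hτ _ =>
    intro h
    rcases h.eq_or_lt with rfl | h
    · exact le_rfl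
    · rw [ppow_limit hτ]
      exact iInf_le (fun ρ : Set.Iio τ => ppow p G ρ.1) ⟨σ, h⟩

theorem map_mem_ppow (g : G →+ G) (σ : Ordinal.{u}) :
    ∀ {x : G}, x ∈ ppow p G σ → g x ∈ ppow p G σ := by
  induction σ using Ordinal.limitRecOn with
  | zero => intro x _; rw [ppow_zero]; trivial
  | add_one σ ih =>
    intro x hx
    rw [ppow_succ] at *
    obtain ⟨y, hy, rfl⟩ := hx
    exact ⟨g y, ih hy, by simp⟩
  | limit σ hσ ih =>
    intro x hx
    rw [ppow_limit hσ, AddSubgroup.mem_iInf] at *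
    exact fun τ => ih τ.1 τ.2 (hx τ)

/-- The least `ρ` with `x ∉ ppow p G ρ` is neither zero nor a limit, so it is the successor of the
height. -/
theorem coe_le_height {σ : Ordinal.{u}} {x : G} :
    (σ : WithTop Ordinal.{u}) ≤ height p x ↔ x ∈ ppow p G σ := by
  constructor
  · intro h
    by_contra hx
    obtain ⟨ρ, hρ, hmin⟩ := WellFounded.has_min (wellFounded_lt (α := Ordinal.{u}))
      {τ | x ∉ ppow p G τ} ⟨σ, hx⟩
    have hρσ : ρ ≤ σ := not_lt.mp (hmin σ hx)
    have below : ∀ τ < ρ, x ∈ ppow p G τ := fun τ hτ => by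
      by_contra hc
      exact hmin τ hc hτ
    rcases Ordinal.zero_or_succ_or_isSuccLimit ρ with rfl | ⟨τ, rfl⟩ | hlim
    · exact hρ (by rw [ppow_zero]; trivial)
    · have hτ : x ∉ ppow p G (τ + 1) := hρ
      have hle : height p x ≤ (τ : WithTop Ordinal.{u}) := by
        rw [height, if_pos ⟨τ, hτ⟩]
        exact WithTop.coe_le_coe.mpr (csInf_le' hτ)
      have := WithTop.coe_le_coe.mp (h.trans hle)
      exact absurd (hρσ.trans this) (not_le.mpr (Order.lt_succ τ))
    · apply hρ
      rw [ppow_limit hlim, AddSubgroup.mem_iInf]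
      exact fun τ => below τ.1 τ.2
  · intro hx
    rw [height]
    split_ifs with h
    · refine WithTop.coe_le_coe.mpr (le_csInf h fun τ hτ => ?_)
      by_contra hlt
      exact hτ (ppow_antitone (Order.succ_le_of_lt (not_le.mp hlt)) hx)
    · exact le_top

theorem height_le_height_iff {x y : G} :
    height p x ≤ height p y ↔ ∀ σ : Ordinal.{u}, x ∈ ppow p G σ → y ∈ ppow p G σ := by
  simp only [← coe_le_height]
  refine ⟨fun h σ hσ => hσ.trans h, fun h => ?_⟩
  induction hx : height p x with
  | top =>
    rw [top_le_iff, WithTop.eq_top_iff_forall_ge]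
    intro σ
    exact h σ (by rw [hx]; exact le_top)
  | coe σ => exact h σ hx.ge

theorem height_le_height_map (g : G →+ G) (x : G) : height p x ≤ height p (g x) :=
  height_le_height_iff.mpr fun σ => map_mem_ppow g σ

theorem ppow_natCast (k : ℕ) : ppow p G k = (nsmulAddMonoidHom (α := G) (p ^ k)).range := by
  induction k with
  | zero =>
    rw [Nat.cast_zero, ppow_zero, eq_comm, AddMonoidHom.range_eq_top]
    exact fun x => ⟨x, by simp⟩
  | succ k ih =>
    rw [Nat.cast_succ, ppow_succ, ih]
    ext x
    constructor
    · rintro ⟨_, ⟨y, rfl⟩, rfl⟩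
      exact ⟨y, by simp [pow_succ', mul_smul]⟩
    · rintro ⟨y, rfl⟩
      exact ⟨p ^ k • y, ⟨y, rfl⟩, by simp [pow_succ', mul_smul]⟩

theorem mem_ppow_natCast {k : ℕ} {x : G} : x ∈ ppow p G k ↔ ∃ y : G, p ^ k • y = x := by
  rw [ppow_natCast]; rfl

theorem ppow_natCast_antitone {i j : ℕ} (h : i ≤ j) : ppow p G j ≤ ppow p G i :=
  ppow_antitone (Nat.cast_le.mpr h)

end Heights

/-! ### Extending height-nondecreasing partial maps -/

section Extension

variable {p : ℕ} {G : Type u} [AddCommGroup G]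

/-- A subgroup of `G × G` that is the graph of a partial homomorphism which does not decrease
heights up to `k`. -/
def IsHeightGraph (p k : ℕ) (Γ : AddSubgroup (G × G)) : Prop :=
  ∀ z ∈ Γ, (z.1 = 0 → z.2 = 0) ∧ ∀ j ≤ k, z.1 ∈ ppow p G j → z.2 ∈ ppow p G j

theorem mem_of_zsmul_mem_of_prime (hp : p.Prime) {D : AddSubgroup G} {x : G} {m : ℤ}
    (hm : ¬ (p : ℤ) ∣ m) (hpx : p • x ∈ D) (hmx : m • x ∈ D) : x ∈ D := by
  obtain ⟨a, b, hab⟩ := (Nat.prime_iff_prime_int.mp hp).coprime_iff_not_dvd.mpr hm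
  have : x = a • (p • x) + b • (m • x) := by
    rw [← natCast_zsmul x p, ← mul_smul, ← mul_smul, ← add_smul, hab, one_smul]
  rw [this]
  exact D.add_mem (D.zsmul_mem hpx a) (D.zsmul_mem hmx b)

theorem IsHeightGraph.exists_gt (hp : p.Prime) (hG : IsPrimaryGroup p G) {k : ℕ}
    {Γ : AddSubgroup (G × G)} (hΓ : IsHeightGraph p k Γ)
    (hk : ppow p G k ≤ Γ.map (AddMonoidHom.fst G G) ∨ ppow p G k ≤ ppow p G (k + 1 : ℕ))
    (hdom : Γ.map (AddMonoidHom.fst G G) ≠ ⊤) :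
    ∃ Γ' : AddSubgroup (G × G), Γ < Γ' ∧ IsHeightGraph p k Γ' := by
  classical
  set D := Γ.map (AddMonoidHom.fst G G)
  have memD : ∀ z ∈ Γ, z.1 ∈ D := fun z hz => ⟨z, hz, rfl⟩
  let Adm : ℕ → Prop := fun j => ∃ x : G, x ∉ D ∧ p • x ∈ D ∧ x ∈ ppow p G j
  have adm_zero : Adm 0 := by
    obtain ⟨x, -, hx⟩ := SetLike.exists_of_lt (lt_top_iff_ne_top.mpr hdom)
    have hex : ∃ r : ℕ, p ^ r • x ∈ D := by
      obtain ⟨r, hr⟩ := hG x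
      exact ⟨r, by rw [hr]; exact D.zero_mem⟩
    obtain ⟨r, hr⟩ : ∃ r, Nat.find hex = r + 1 := by
      refine Nat.exists_eq_succ_of_ne_zero fun h0 => hx ?_
      have := Nat.find_spec hex
      rw [h0] at this
      simpa using this
    refine ⟨p ^ r • x, Nat.find_min hex (by omega), ?_, ?_⟩
    · have := Nat.find_spec hex
      rw [hr] at this
      rwa [← mul_smul, ← pow_succ']
    · rw [Nat.cast_zero, ppow_zero]; trivial
  -- Choosing `x` as high as possible (up to level `k`) in its coset of `D` makes heights on the
  -- enlarged domain controllable.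
  set j := Nat.findGreatest Adm k
  have hjk : j ≤ k := Nat.findGreatest_le k
  obtain ⟨x, hxD, hpx, hxj⟩ : Adm j := Nat.findGreatest_spec (Nat.zero_le k) adm_zero
  have hmax : ∀ i ≤ k, Adm i → i ≤ j := fun i hi h => Nat.le_findGreatest hi h
  obtain ⟨⟨_, t⟩, hst, rfl⟩ := id hpx
  obtain ⟨y, hyj, hy⟩ : ∃ y ∈ ppow p G j, p • y = t := by
    have hpxi : ∀ i : ℕ, x ∈ ppow p G i → p • x ∈ ppow p G (i + 1 : ℕ) := fun i hi => by
      rw [Nat.cast_succ, ppow_succ]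
      exact ⟨x, hi, rfl⟩
    -- At `j = k` the graph says nothing about level `k + 1`; `hk` fills this gap.
    have ht : t ∈ ppow p G (j + 1 : ℕ) := by
      rcases hjk.lt_or_eq with hlt | heq
      · exact (hΓ _ hst).2 (j + 1) hlt (hpxi j hxj)
      · rcases hk with hk | hk
        · exact absurd (hk (heq ▸ hxj)) hxD
        · rw [heq]
          exact hk ((hΓ _ hst).2 k le_rfl
            (ppow_natCast_antitone (Nat.le_succ k) (hpxi k (heq ▸ hxj))))
    rw [Nat.cast_succ, ppow_succ] at ht
    exact ht
  have hxy : (p • x, p • y) ∈ Γ := hy ▸ hst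
  have hle : Γ ≤ Γ ⊔ AddSubgroup.zmultiples (x, y) := le_sup_left
  refine ⟨Γ ⊔ AddSubgroup.zmultiples (x, y), lt_of_le_of_ne hle fun heq => hxD ?_, ?_⟩
  · refine memD (x, y) (heq ▸ ?_)
    exact (le_sup_right : _ ≤ Γ ⊔ _) (AddSubgroup.mem_zmultiples (x, y))
  intro z hz
  obtain ⟨w, hw, _, ⟨m, rfl⟩, rfl⟩ := AddSubgroup.mem_sup.mp hz
  by_cases hm : (p : ℤ) ∣ m
  · obtain ⟨m, rfl⟩ := hm
    refine hΓ _ (Γ.add_mem hw ?_)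
    have : ((p : ℤ) * m) • (x, y) = m • (p • x, p • y) := by
      rw [mul_comm, mul_smul, natCast_zsmul]; rfl
    simpa only [this] using Γ.zsmul_mem hxy m
  · have hzD : w.1 + m • x ∉ D := fun h =>
      hxD (mem_of_zsmul_mem_of_prime hp hm hpx (by
        simpa using D.sub_mem h (memD w hw)))
    have hpz : p • (w.1 + m • x) ∈ D := by
      rw [smul_add, smul_comm]
      exact D.add_mem (D.nsmul_mem (memD w hw) p) (D.zsmul_mem hpx m)
    refine ⟨fun h0 => absurd D.zero_mem (h0 ▸ hzD), fun i hik hi => ?_⟩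
    -- The new element is itself admissible, so `i ≤ j`; hence `x` and `y` lie in `p ^ i G` and the
    -- claim reduces to `w`.
    have hij := ppow_natCast_antitone (p := p) (G := G) (hmax i hik ⟨_, hzD, hpz, hi⟩)
    have hwi : w.1 ∈ ppow p G i := by
      simpa using AddSubgroup.sub_mem _ hi (AddSubgroup.zsmul_mem _ (hij hxj) m)
    exact AddSubgroup.add_mem _ ((hΓ w hw).2 i hik hwi) (AddSubgroup.zsmul_mem _ (hij hyj) m)

theorem exists_extension (hp : p.Prime) (hG : IsPrimaryGroup p G) {k : ℕ} (S : AddSubgroup G)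
    (hk : ppow p G k ≤ S ∨ ppow p G k ≤ ppow p G (k + 1 : ℕ)) (f : S →+ G)
    (hf : ∀ j : ℕ, j ≤ k → ∀ x : S, (x : G) ∈ ppow p G j → f x ∈ ppow p G j) :
    ∃ g : G →+ G, ∀ x : S, g x = f x := by
  let Γ₀ : AddSubgroup (G × G) := (S.subtype.prod f).range
  have h₀ : IsHeightGraph p k Γ₀ := by
    rintro _ ⟨x, rfl⟩
    refine ⟨fun hx => ?_, fun j hj hx => hf j hj x hx⟩
    have : x = 0 := Subtype.ext hx
    simp [this]
  obtain ⟨Γ, hΓ₀, hΓ⟩ := zorn_le_nonempty₀ {Γ : AddSubgroup (G × G) | IsHeightGraph p k Γ}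
    (fun c hc hchain Δ hΔ => by
      refine ⟨sSup c, fun z hz => ?_, fun _ h => le_sSup h⟩
      obtain ⟨Λ, hΛ, hz⟩ :=
        (AddSubgroup.mem_sSup_of_directedOn ⟨Δ, hΔ⟩ hchain.directedOn).mp hz
      exact hc hΛ z hz) Γ₀ h₀
  have hSD : S ≤ Γ.map (AddMonoidHom.fst G G) := fun x hx =>
    ⟨(x, f ⟨x, hx⟩), hΓ₀ ⟨⟨x, hx⟩, rfl⟩, rfl⟩
  have hdom : Γ.map (AddMonoidHom.fst G G) = ⊤ := by
    by_contra hne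
    obtain ⟨Γ', hlt, hΓ'⟩ := hΓ.prop.exists_gt hp hG (hk.imp_left (·.trans hSD)) hne
    exact hlt.not_ge (hΓ.le_of_ge hΓ' hlt.le)
  let π : Γ →+ G := (AddMonoidHom.fst G G).comp Γ.subtype
  have hπ : Function.Bijective π := by
    refine ⟨(injective_iff_map_eq_zero π).mpr fun z hz => ?_, fun x => ?_⟩
    · exact Subtype.ext (Prod.ext hz ((hΓ.prop z z.2).1 hz))
    · obtain ⟨z, hz, hzx⟩ : x ∈ Γ.map (AddMonoidHom.fst G G) := by rw [hdom]; trivial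
      exact ⟨⟨z, hz⟩, hzx⟩
  let e : Γ ≃+ G := AddEquiv.ofBijective π hπ
  refine ⟨((AddMonoidHom.snd G G).comp Γ.subtype).comp e.symm.toAddMonoidHom, fun x => ?_⟩
  have : e.symm (x : G) = ⟨(x, f x), hΓ₀ ⟨x, rfl⟩⟩ := by
    rw [AddEquiv.symm_apply_eq]; rfl
  change ((e.symm (x : G) : Γ) : G × G).2 = f x
  rw [this]

end Extension

/-! ### Direct sums and valuated direct sums -/

section DirectSum

variable {G : Type u} [AddCommGroup G] {n : ℕ} {H : AddSubgroup G} {K : Fin n → AddSubgroup G}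

theorem IsDirectSum.le (h : IsDirectSum H K) (i : Fin n) : K i ≤ H :=
  h.iSup_eq ▸ le_iSup K i

theorem IsDirectSum.exists_equiv (h : IsDirectSum H K) :
    ∃ e : ((i : Fin n) → K i) ≃+ H, ∀ x, (e x : G) = ∑ i, (x i : G) := by
  have hcomm : Pairwise fun i j : Fin n => ∀ x y : G, x ∈ K i → y ∈ K j → AddCommute x y :=
    fun _ _ _ x y _ _ => AddCommute.all x y
  let φ := AddSubgroup.noncommPiCoprod hcomm
  have hφ : ∀ x, φ x = ∑ i, (x i : G) := fun x => by
    rw [AddSubgroup.noncommPiCoprod_apply, Finset.noncommSum_eq_sum]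
  have hinj : Function.Injective φ :=
    AddSubgroup.injective_noncommPiCoprod_of_iSupIndep h.indep
  have hrange : φ.range = H := AddSubgroup.noncommPiCoprod_range.trans h.iSup_eq
  subst hrange
  exact ⟨AddMonoidHom.ofInjective hinj, hφ⟩

theorem IsDirectSum.exists_proj (h : IsDirectSum H K) (i : Fin n) :
    ∃ π : H →+ K i, ∀ (x : (i : Fin n) → K i) (y : H), (y : G) = ∑ i, (x i : G) → π y = x i := by
  obtain ⟨e, he⟩ := h.exists_equiv
  refine ⟨(Pi.evalAddMonoidHom (fun i => K i) i).comp e.symm.toAddMonoidHom, fun x y hxy => ?_⟩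
  have : y = e x := Subtype.ext (hxy.trans (he x).symm)
  simp [this]

theorem IsDirectSum.exists_sum (h : IsDirectSum H K) (y : H) :
    ∃ x : (i : Fin n) → K i, (y : G) = ∑ i, (x i : G) := by
  obtain ⟨e, he⟩ := h.exists_equiv
  exact ⟨e.symm y, by rw [← he, e.apply_symm_apply]⟩

theorem IsDirectSum.mem_calQ (h : IsDirectSum H K) (hH : H ∈ calQ G) (i : Fin n) :
    K i ∈ calQ G := by
  intro f
  obtain ⟨π, hπ⟩ := h.exists_proj i
  obtain ⟨g, hg⟩ := hH (f.comp π)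
  refine ⟨g, fun x => ?_⟩
  rw [hg ⟨x, h.le i x.2⟩, AddMonoidHom.comp_apply,
    hπ (Pi.single i x) ⟨x, h.le i x.2⟩ ?_, Pi.single_eq_same]
  rw [Finset.sum_eq_single i (fun j _ hj => by simp [Pi.single_eq_of_ne hj]) (by simp)]
  simp

theorem IsDirectSum.isValuatedDirectSum (p : ℕ) (h : IsDirectSum H K) (hH : H ∈ calQ G) :
    IsValuatedDirectSum p H K := by
  refine ⟨h, fun x hx => le_antisymm (Finset.le_inf fun i _ => ?_) ?_⟩
  · obtain ⟨π, hπ⟩ := h.exists_proj i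
    obtain ⟨g, hg⟩ := hH ((K i).subtype.comp π)
    have hmem : ∑ i, x i ∈ H := H.sum_mem fun i _ => h.le i (hx i)
    have : g (∑ i, x i) = x i := by
      rw [hg ⟨_, hmem⟩, AddMonoidHom.comp_apply, hπ (fun i => ⟨x i, hx i⟩) ⟨_, hmem⟩ rfl]
      rfl
    simpa [this] using height_le_height_map (p := p) g (∑ i, x i)
  · induction hs : Finset.univ.inf fun i => height p (x i) with
    | top =>
      rw [top_le_iff, WithTop.eq_top_iff_forall_ge]
      intro σ
      refine coe_le_height.mpr (AddSubgroup.sum_mem _ fun i _ => coe_le_height.mp ?_)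
      exact (le_top.trans hs.ge).trans (Finset.inf_le (Finset.mem_univ i))
    | coe σ =>
      refine coe_le_height.mpr (AddSubgroup.sum_mem _ fun i _ => coe_le_height.mp ?_)
      exact hs.ge.trans (Finset.inf_le (Finset.mem_univ i))

theorem IsValuatedDirectSum.mem_ppow {p : ℕ} (h : IsValuatedDirectSum p H K)
    {x : (i : Fin n) → K i} {σ : Ordinal.{u}} (hx : ∑ i, (x i : G) ∈ ppow p G σ) (i : Fin n) :
    (x i : G) ∈ ppow p G σ := by
  rw [← coe_le_height, h.height_sum (fun i => (x i : G)) fun i => (x i).2] at hx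
  exact coe_le_height.mp (hx.trans (Finset.inf_le (Finset.mem_univ i)))

theorem IsValuatedDirectSum.map_mem_ppow {p : ℕ} (h : IsValuatedDirectSum p H K)
    (hK : ∀ i, K i ∈ calQ G) (f : H →+ G) {σ : Ordinal.{u}} {x : H}
    (hx : (x : G) ∈ ppow p G σ) : f x ∈ ppow p G σ := by
  obtain ⟨y, hy⟩ := h.toIsDirectSum.exists_sum x
  have hle := h.toIsDirectSum.le
  have hxy : x = ∑ i, AddSubgroup.inclusion (hle i) (y i) := by
    apply Subtype.ext
    rw [hy, AddSubgroup.val_finsetSum]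
    rfl
  rw [hxy, map_sum]
  refine AddSubgroup.sum_mem _ fun i _ => ?_
  obtain ⟨g, hg⟩ := hK i (f.comp (AddSubgroup.inclusion (hle i)))
  rw [← AddMonoidHom.comp_apply, ← hg]
  exact HomExtension.map_mem_ppow g σ (h.mem_ppow (hy ▸ hx) i)

end DirectSum

/-! ### Finite heights in cyclic members of `calQ G` -/

section Cyclic

variable {p : ℕ} {G : Type u} [AddCommGroup G]

/-- If the elements of `p ^ k G` of order at most `p` all lie in `p ^ (k + 1) G`, then
`p ^ k G` is divisible by `p`. -/
theorem ppow_le_ppow_succ_of_socle (hG : IsPrimaryGroup p G) {k : ℕ}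
    (h : ∀ x ∈ ppow p G k, p • x = 0 → ∀ m : ℕ, x ∈ ppow p G m) :
    ppow p G k ≤ ppow p G (k + 1 : ℕ) := by
  have key : ∀ (r : ℕ), ∀ x ∈ ppow p G k, p ^ r • x = 0 → x ∈ ppow p G (k + 1 : ℕ) := by
    intro r
    induction r with
    | zero =>
      intro x _ hx
      rw [pow_zero, one_smul] at hx
      rw [hx]; exact AddSubgroup.zero_mem _
    | succ r ih =>
      intro x hx hr
      -- Subtracting `p ^ (k + 1) • z` from `x` lowers the exponent of its order.
      obtain ⟨z, hz⟩ := mem_ppow_natCast.mp (h (p ^ r • x) (AddSubgroup.nsmul_mem _ hx _)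
        (by rwa [← mul_smul, ← pow_succ']) (r + (k + 1)))
      have hz' : p ^ (k + 1) • z ∈ ppow p G (k + 1 : ℕ) := mem_ppow_natCast.mpr ⟨z, rfl⟩
      have := ih (x - p ^ (k + 1) • z)
        (AddSubgroup.sub_mem _ hx (ppow_natCast_antitone (Nat.le_succ k) hz'))
        (by rw [smul_sub, ← mul_smul, ← pow_add, hz, sub_self])
      simpa using AddSubgroup.add_mem _ this hz'
  intro x hx
  obtain ⟨r, hr⟩ := hG x
  exact key r x hx hr

/-- If no `p ^ k G` is divisible, then the nonzero elements of a cyclic subgroup in `Q(G)` have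
finite height. -/
theorem exists_notMem_ppow_of_mem_calQ (hp : p.Prime) (hG : IsPrimaryGroup p G)
    (hdiv : ∀ k : ℕ, ¬ ppow p G k ≤ ppow p G (k + 1 : ℕ)) {C : AddSubgroup G}
    (hC : IsAddCyclic C) (hCQ : C ∈ calQ G) {x : G} (hx : x ∈ C) (hx0 : x ≠ 0) :
    ∃ m : ℕ, x ∉ ppow p G m := by
  classical
  have := Fact.mk hp
  obtain ⟨a, ha⟩ : ∃ a : C, ∀ c, c ∈ AddSubgroup.zmultiples a := hC.exists_zsmul_surjective
  obtain ⟨n, hn⟩ : ∃ n, addOrderOf a = p ^ n := by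
    obtain ⟨r, hr⟩ := hG a
    exact exists_addOrderOf_eq_prime_pow_iff.mpr ⟨r, Subtype.ext hr⟩
  obtain ⟨l, hl⟩ := ha ⟨x, hx⟩
  replace hl : l • (a : G) = x := congrArg Subtype.val hl
  have hna : p ^ n • (a : G) = 0 := by
    have := addOrderOf_nsmul_eq_zero a
    rw [hn] at this
    exact congrArg Subtype.val this
  obtain _ | s := n
  · rw [pow_zero, one_smul] at hna
    exact absurd (by rw [← hl, hna, smul_zero]) hx0
  -- With `z = p ^ s • y`, the map `a ↦ y` is well defined and its extension sends `p ^ s • a` to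
  -- `z`, so `p ^ s • a` has finite height.
  obtain ⟨z, hzs, hpz, m, hzm⟩ : ∃ z ∈ ppow p G s, p • z = 0 ∧ ∃ m : ℕ, z ∉ ppow p G m := by
    by_contra! hc
    exact hdiv s (ppow_le_ppow_succ_of_socle hG hc)
  obtain ⟨y, rfl⟩ := mem_ppow_natCast.mp hzs
  obtain ⟨g, hg⟩ := hCQ (addMonoidHomOfForallMemZMultiples (g := a) (g' := y) ha (by
    rw [hn]
    exact addOrderOf_dvd_of_nsmul_eq_zero (by rw [pow_succ', mul_smul, hpz])))
  have hgy : g a = y := by rw [hg, addMonoidHomOfForallMemZMultiples_apply_gen]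
  refine ⟨m, fun hxm => hzm ?_⟩
  rw [← hgy, ← map_nsmul]
  apply map_mem_ppow g
  have hex : ∃ t : ℕ, p ^ t • x = 0 := hG x
  obtain ⟨t, ht⟩ : ∃ t, Nat.find hex = t + 1 :=
    Nat.exists_eq_succ_of_ne_zero fun h0 => hx0 (by simpa [h0] using Nat.find_spec hex)
  have hw0 : p ^ t • x ≠ 0 := Nat.find_min hex (by omega)
  have hpw : p ^ (t + 1) • x = 0 := ht ▸ Nat.find_spec hex
  -- The multiple `p ^ t • x` has order `p`, so it is `c • (p ^ s • a)` with `c` prime to `p`; hence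
  -- `p ^ s • a` is a multiple of `x`.
  have hdvd : (p : ℤ) ^ s ∣ (p : ℤ) ^ t * l := by
    have h0 : ((p : ℤ) ^ (t + 1) * l) • a = 0 := by
      apply Subtype.ext
      change ((p : ℤ) ^ (t + 1) * l) • (a : G) = 0
      rw [mul_smul, hl, ← Nat.cast_pow, natCast_zsmul, hpw]
    have := addOrderOf_dvd_iff_zsmul_eq_zero.mpr h0
    rw [hn, Nat.cast_pow, pow_succ', pow_succ', mul_assoc] at this
    exact (mul_dvd_mul_iff_left (by exact_mod_cast hp.ne_zero)).mp this
  obtain ⟨c, hc⟩ := hdvd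
  have hw : c • (p ^ s • (a : G)) = p ^ t • x := by
    rw [← hl, ← natCast_zsmul, ← natCast_zsmul, ← mul_smul, ← mul_smul, mul_comm c,
      Nat.cast_pow, Nat.cast_pow, hc]
  refine mem_of_zsmul_mem_of_prime hp (m := c) ?_ ?_ ?_
  · rintro ⟨d, rfl⟩
    apply hw0
    rw [← hw, mul_comm, mul_smul, natCast_zsmul, ← mul_smul, ← pow_succ', hna, smul_zero]
  · rw [← mul_smul, ← pow_succ', hna]
    exact AddSubgroup.zero_mem _
  · rw [hw]
    exact AddSubgroup.nsmul_mem _ hxm _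

end Cyclic

theorem IsValuatedDirectSum.mem_calQ {p : ℕ} (hp : p.Prime) {G : Type u} [AddCommGroup G]
    (hG : IsPrimaryGroup p G) {n : ℕ} {H : AddSubgroup G} [Finite H] {K : Fin n → AddSubgroup G}
    (hcyc : ∀ i, IsAddCyclic (K i)) (hK : ∀ i, K i ∈ calQ G) (h : IsValuatedDirectSum p H K) :
    H ∈ calQ G := by
  intro f
  have hf : ∀ (j : ℕ) (x : H), (x : G) ∈ ppow p G j → f x ∈ ppow p G j :=
    fun j x => h.map_mem_ppow hK f
  by_cases hdiv : ∃ k : ℕ, ppow p G k ≤ ppow p G (k + 1 : ℕ)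
  · obtain ⟨k, hk⟩ := hdiv
    exact exists_extension hp hG H (Or.inr hk) f fun j _ => hf j
  push Not at hdiv
  have hfin : ∀ x : H, ∃ m : ℕ, (x : G) ∈ ppow p G m → x = 0 := by
    intro x
    by_cases hx : x = 0
    · exact ⟨0, fun _ => hx⟩
    obtain ⟨y, hy⟩ := h.toIsDirectSum.exists_sum x
    obtain ⟨i, hi⟩ : ∃ i, (y i : G) ≠ 0 := by
      by_contra! hc
      exact hx (Subtype.ext (by simp [hy, hc]))
    obtain ⟨m, hm⟩ := exists_notMem_ppow_of_mem_calQ hp hG hdiv (hcyc i) (hK i) (y i).2 hi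
    exact ⟨m, fun hxm => absurd (h.mem_ppow (hy ▸ hxm) i) hm⟩
  choose m hm using hfin
  obtain ⟨k, hk⟩ := (Set.finite_range m).bddAbove
  have hdisj : ∀ x : H, (x : G) ∈ ppow p G k → x = 0 := fun x hx =>
    hm x (ppow_natCast_antitone (hk ⟨x, rfl⟩) hx)
  -- Extend `f` by zero to `H ⊕ p ^ k G`.
  let ψ : H × ppow p G k →+ G := H.subtype.coprod (ppow p G k).subtype
  have hψ : Function.Injective ψ := by
    refine (injective_iff_map_eq_zero ψ).mpr fun z hz => ?_
    have hz' : (z.1 : G) + z.2 = 0 := hz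
    have h1 : z.1 = 0 := hdisj z.1 (by
      rw [eq_neg_of_add_eq_zero_left hz']; exact AddSubgroup.neg_mem _ z.2.2)
    refine Prod.ext h1 (Subtype.ext ?_)
    simpa [h1] using hz'
  let e := AddMonoidHom.ofInjective hψ
  have he : ∀ z, (e z : G) = z.1 + z.2 := fun z => rfl
  obtain ⟨g, hg⟩ := exists_extension hp hG (k := k) ψ.range
    (Or.inl fun x hx => ⟨(0, ⟨x, hx⟩), by simp [ψ]⟩)
    ((f.comp (AddMonoidHom.fst _ _)).comp e.symm.toAddMonoidHom) (fun j hj y hy => by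
      obtain ⟨z, rfl⟩ := e.surjective y
      have : (z.1 : G) ∈ ppow p G j := by
        have := AddSubgroup.sub_mem _ (he z ▸ hy) (ppow_natCast_antitone hj z.2.2)
        simpa using this
      simpa using hf j z.1 this)
  refine ⟨g, fun x => ?_⟩
  have := hg (e (x, 0))
  simpa [he] using this

end HomExtension

theorem mainTheorem2 {p : ℕ} (hp : p.Prime) {G : Type*} [AddCommGroup G]
    (hG : HomExtension.IsPrimaryGroup p G) {n : ℕ} (H : AddSubgroup G) (hH : Finite H)
    (K : Fin n → AddSubgroup G) (hK : ∀ i, IsAddCyclic (K i))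
    (hsum : HomExtension.IsDirectSum H K) :
    H ∈ HomExtension.calQ G ↔
      (∀ i, K i ∈ HomExtension.calQ G) ∧ HomExtension.IsValuatedDirectSum p H K :=
  ⟨fun h => ⟨fun i => hsum.mem_calQ h i, hsum.isValuatedDirectSum p h⟩,
    fun h => h.2.mem_calQ hp hG hK h.1⟩
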